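/- Let $p, p'$ be primes, let $F$ be a finite extension of $\mathbb{Q}_p$ and $F'$ a finite extension of $\mathbb{Q}_{p'}$ (that is, $F, F'$ are non-Archimedean local fields of characteristic zero), and let $\Xi/F$ and $\Xi'/F'$ be (possibly infinite) Galois extensions. Assume that $\Xi$ is abundant, meaning that $\Xi$ contains the maximal tamely ramified extension of $\mathbb{Q}_p$ (the compositum of all finite extensions of $\mathbb{Q}_p$ with ramification index prime to $p$) or the $\mathbb{Z}_p^2$-extension of $\mathbb{Q}_p$ (the Galois extension of $\mathbb{Q}_p$ whose Galois group is topologically isomorphic to $\mathbb{Z}_p \times \mathbb{Z}_p$). Suppose that there is an embedding of profinite groups, i.e. a continuous injective homomorphism, $\alpha : \mathrm{Gal}(\Xi/F) \to \mathrm{Gal}(\Xi'/F')$. Then $F$ and $F'$ have the same residue characteristic. -/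

import Mathlib

namespace PadicGalois

open IsLocalRing

section

variable (p : ℕ) [Fact p.Prime] (L : Type*) [Field L] [Algebra ℚ_[p] L]
  [Algebra.IsAlgebraic ℚ_[p] L]

/-- The valuation ring of an algebraic extension `L` of `ℚ_p`: the closed unit ball of the unique
absolute value on `L` that extends the `p`-adic one (Mathlib's `spectralNorm`). -/
noncomputable def valuationRing : ValuationSubring L where
  carrier := {x | spectralNorm ℚ_[p] L x ≤ 1}
  mul_mem' {x y} hx hy := by
    have h : spectralNorm ℚ_[p] L (x * y) = spectralNorm ℚ_[p] L x * spectralNorm ℚ_[p] L y :=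
      map_mul (spectralMulAlgNorm ℚ_[p] L) x y
    exact h.le.trans (mul_le_one₀ hx (spectralNorm_nonneg y) hy)
  one_mem' := (map_one (spectralMulAlgNorm ℚ_[p] L)).le
  add_mem' {x y} hx hy := (isNonarchimedean_spectralNorm x y).trans (max_le hx hy)
  zero_mem' := (map_zero (spectralMulAlgNorm ℚ_[p] L)).le.trans zero_le_one
  neg_mem' {x} hx := (map_neg_eq_map (spectralMulAlgNorm ℚ_[p] L) x).le.trans hx
  mem_or_inv_mem' x := by
    by_cases hx : spectralNorm ℚ_[p] L x ≤ 1
    · exact Or.inl hx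
    · have h : spectralNorm ℚ_[p] L x⁻¹ = (spectralNorm ℚ_[p] L x)⁻¹ :=
        map_inv₀ (spectralMulAlgNorm ℚ_[p] L) x
      exact Or.inr (h.le.trans (inv_le_one_of_one_le₀ (not_le.mp hx).le))

/-- The structure map `ℤ_p → 𝒪_L`, the restriction of `ℚ_p → L`. -/
noncomputable def padicIntToValuationRing : ℤ_[p] →+* valuationRing p L :=
  ((algebraMap ℚ_[p] L).comp (algebraMap ℤ_[p] ℚ_[p])).codRestrict (valuationRing p L)
    fun x => (spectralNorm_extends (algebraMap ℤ_[p] ℚ_[p] x)).le.trans x.norm_le_one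

noncomputable instance : Algebra ℤ_[p] (valuationRing p L) :=
  (padicIntToValuationRing p L).toAlgebra

/-- The characteristic of the residue field `𝒪_L / 𝔪_L`. -/
noncomputable def residueChar : ℕ := ringChar (ResidueField (valuationRing p L))

/-- The ramification index of `L / ℚ_p`, the exponent `e` with `p 𝒪_L = 𝔪_L ^ e` if `L / ℚ_p` is
finite. -/
noncomputable def ramificationIndex : ℕ :=
  (maximalIdeal (valuationRing p L)).ramificationIdx ℤ_[p]

end

/-- A finite extension of `ℚ_p` is tamely ramified if `p` does not divide its ramification index
(the extension of residue fields is separable because these fields are finite). -/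
def IsTamelyRamified (p : ℕ) [Fact p.Prime] (L : Type*) [Field L] [Algebra ℚ_[p] L]
    [FiniteDimensional ℚ_[p] L] : Prop :=
  ¬ p ∣ ramificationIndex p L

/-- The maximal tamely ramified extension of `ℚ_p`: the compositum, in an algebraic closure, of all
finite tamely ramified extensions of `ℚ_p`. -/
noncomputable def maxTame (p : ℕ) [Fact p.Prime] :
    IntermediateField ℚ_[p] (AlgebraicClosure ℚ_[p]) :=
  ⨆ (L : IntermediateField ℚ_[p] (AlgebraicClosure ℚ_[p]))
    (_ : FiniteDimensional ℚ_[p] L) (_ : IsTamelyRamified p L), L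

/-- An algebraic extension `Ξ` of `ℚ_p` is abundant if it contains the maximal tamely ramified
extension of `ℚ_p` (as this extension is normal, it does not matter how it is embedded) or the
`ℤ_p²`-extension of `ℚ_p`, that is, a Galois extension of `ℚ_p` whose Galois group is isomorphic,
as a topological group, to `ℤ_p × ℤ_p`. -/
def IsAbundant (p : ℕ) [Fact p.Prime] (Ξ : Type*) [Field Ξ] [Algebra ℚ_[p] Ξ] : Prop :=
  Nonempty (maxTame p →ₐ[ℚ_[p]] Ξ) ∨
  ∃ E : IntermediateField ℚ_[p] Ξ, IsGalois ℚ_[p] E ∧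
    Nonempty (Gal(E/ℚ_[p]) ≃ₜ* Multiplicative (ℤ_[p] × ℤ_[p]))

end PadicGalois

/-! Write q for p' and suppose p ≠ q. At a finite level E of Ξ'/F', the automorphisms of E over ℚ_q
are filtered, whether or not E is Galois over ℚ_q. Modulo inertia they are cyclic, generated by a
power of Frobenius; inertia modulo wild inertia is cyclic (`tameCharacter`); wild inertia is a
q-group (`eq_one_of_mem_wildInertia`). An element acting as z ↦ z^(q^j) on the residue field
conjugates inertia by the power q^j, up to wild inertia (`conj_mul_inv_pow_mem_wildInertia`). As α
is a closed embedding, every neighbourhood of 1 in Gal(Ξ/F) is controlled by one such level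
(`exists_level_of_isOpen`).

Tame case (`eq_of_maxTame`): for M prime to p there are a, b in Gal(Ξ/F) acting on ζ_M and p^(1/M)
like N-th powers of Frobenius and of a tame generator. Their commutator c multiplies p^(1/M) by ζ^C,
with C = N(p^N - 1), and its conjugate by a does so by ζ^(C p^N). But α(c), a commutator, is
inertial, so conjugation by α(a) is also the power q^j up to wild inertia. If q ∤ M, then M divides
C(p^N - q^j); `exists_modulus` supplies an M for which no j works.

ℤ_p² case (`eq_of_padicInt_prod_hom`): take a, b independent in ℤ_p². Some coprime combination of
α(a), α(b) is inertial; since ℤ_p² is commutative, every Frobenius exponent j has q^j ≡ 1 modulo a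
high power of p, so j itself is highly divisible by p. Hence powers of exponent prime to p are
already inertial at a smaller level. There a coprime combination of these powers is wild, so killed
by a power of q, contradicting independence. -/

namespace PadicGalois

open IsLocalRing Polynomial

/-! ### The valuation ring as integral closure of ℤ_p -/

section ValuationRing

variable (p : ℕ) [Fact p.Prime] (L : Type*) [Field L] [Algebra ℚ_[p] L]
  [Algebra.IsAlgebraic ℚ_[p] L]

variable {L} in
theorem mem_valuationRing {x : L} : x ∈ valuationRing p L ↔ spectralNorm ℚ_[p] L x ≤ 1 := Iff.rfl

variable {L} in
theorem specNorm_mul (x y : L) : spectralNorm ℚ_[p] L (x * y) =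
    spectralNorm ℚ_[p] L x * spectralNorm ℚ_[p] L y :=
  map_mul (spectralMulAlgNorm ℚ_[p] L) x y

variable {L} in
theorem specNorm_pow (x : L) (n : ℕ) : spectralNorm ℚ_[p] L (x ^ n) =
    spectralNorm ℚ_[p] L x ^ n :=
  map_pow (spectralMulAlgNorm ℚ_[p] L) x n

variable {L} in
theorem specNorm_inv (x : L) : spectralNorm ℚ_[p] L x⁻¹ = (spectralNorm ℚ_[p] L x)⁻¹ :=
  map_inv₀ (spectralMulAlgNorm ℚ_[p] L) x

variable {L} in
theorem specNorm_div (x y : L) : spectralNorm ℚ_[p] L (x / y) =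
    spectralNorm ℚ_[p] L x / spectralNorm ℚ_[p] L y :=
  map_div₀ (spectralMulAlgNorm ℚ_[p] L) x y

variable {L} in
theorem specNorm_pos {x : L} (hx : x ≠ 0) : 0 < spectralNorm ℚ_[p] L x :=
  spectralNorm_zero_lt hx (Algebra.IsAlgebraic.isAlgebraic x)

theorem mem_maximalIdeal_valuationRing {x : valuationRing p L} :
    x ∈ maximalIdeal (valuationRing p L) ↔ spectralNorm ℚ_[p] L x < 1 := by
  rw [mem_maximalIdeal, mem_nonunits_iff, ← not_le, not_iff_not]
  constructor
  · rintro ⟨u, rfl⟩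
    have h : spectralNorm ℚ_[p] L (u.1 : L) * spectralNorm ℚ_[p] L ((u⁻¹).1 : L) = 1 := by
      rw [← specNorm_mul, ← spectralNorm_one (K := ℚ_[p]) (L := L)]
      congr 1
      exact_mod_cast congrArg Subtype.val u.mul_inv
    have h1 : spectralNorm ℚ_[p] L ((u⁻¹).1 : L) ≤ 1 := (u⁻¹).1.2
    have h0 := spectralNorm_nonneg (K := ℚ_[p]) (u.1 : L)
    nlinarith
  · intro h
    have h0 : (x : L) ≠ 0 := by
      intro h0
      rw [h0, spectralNorm_zero] at h
      linarith
    refine IsUnit.of_mul_eq_one ⟨(x : L)⁻¹, ?_⟩ (Subtype.ext (mul_inv_cancel₀ h0))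
    rw [mem_valuationRing, specNorm_inv]
    exact inv_le_one_of_one_le₀ h

/-- The algebra structure over `ℤ_p` of an extension of `ℚ_p`. -/
noncomputable abbrev padicIntAlgebra : Algebra ℤ_[p] L :=
  ((algebraMap ℚ_[p] L).comp (algebraMap ℤ_[p] ℚ_[p])).toAlgebra

attribute [local instance] padicIntAlgebra

instance : IsScalarTower ℤ_[p] ℚ_[p] L := .of_algebraMap_eq' rfl

instance : IsScalarTower ℤ_[p] (valuationRing p L) L := .of_algebraMap_eq' rfl

/-- The spectral norm is at most 1 exactly when the minimal polynomial has coefficients in ℤ_p,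
which is integrally closed. -/
theorem isIntegral_iff_mem_valuationRing {x : L} :
    IsIntegral ℤ_[p] x ↔ x ∈ valuationRing p L := by
  have hint : IsIntegral ℚ_[p] x := Algebra.IsIntegral.isIntegral x
  rw [mem_valuationRing, spectralNorm, spectralValue_le_one_iff (minpoly.monic hint)]
  constructor
  · intro h n
    rw [minpoly.isIntegrallyClosed_eq_field_fractions' ℚ_[p] h, coeff_map]
    exact PadicInt.norm_le_one _
  · intro h
    have hl : minpoly ℚ_[p] x ∈ lifts (algebraMap ℤ_[p] ℚ_[p]) := by
      rw [lifts_iff_coeff_lifts]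
      exact fun n => ⟨⟨_, h n⟩, rfl⟩
    obtain ⟨P, hP, -, hm⟩ := lifts_and_natDegree_eq_and_monic hl (minpoly.monic hint)
    refine ⟨P, hm, ?_⟩
    rw [← aeval_def, ← aeval_map_algebraMap ℚ_[p], hP, minpoly.aeval]

instance : IsIntegralClosure (valuationRing p L) ℤ_[p] L where
  algebraMap_injective := Subtype.val_injective
  isIntegral_iff {x} := by
    rw [isIntegral_iff_mem_valuationRing]
    exact ⟨fun h => ⟨⟨x, h⟩, rfl⟩, fun ⟨y, hy⟩ => hy ▸ y.2⟩

omit [Algebra.IsAlgebraic ℚ_[p] L] in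
theorem specNorm_p : spectralNorm ℚ_[p] L (p : L) = (p : ℝ)⁻¹ := by
  have h := spectralNorm_extends (K := ℚ_[p]) (L := L) (p : ℚ_[p])
  rwa [map_natCast, Padic.norm_p] at h

theorem p_mem_maximalIdeal : (p : valuationRing p L) ∈ maximalIdeal (valuationRing p L) := by
  rw [mem_maximalIdeal_valuationRing]
  push_cast
  rw [specNorm_p]
  exact inv_lt_one_of_one_lt₀ (by exact_mod_cast (Fact.out : p.Prime).one_lt)

instance : CharP (ResidueField (valuationRing p L)) p :=
  (CharP.charP_iff_prime_eq_zero Fact.out).mpr <| by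
    rw [← map_natCast (residue (valuationRing p L)), residue_eq_zero_iff]
    exact p_mem_maximalIdeal p L

theorem residueChar_eq : residueChar p L = p :=
  ringChar.eq (ResidueField (valuationRing p L)) p

theorem p_ne_zero_valuationRing : (p : valuationRing p L) ≠ 0 := by
  have : CharZero L := charZero_of_injective_algebraMap (algebraMap ℚ_[p] L).injective
  exact fun h => (Fact.out : p.Prime).ne_zero (by exact_mod_cast congrArg Subtype.val h)

theorem algebraMap_valuationRing_injective :
    Function.Injective (algebraMap ℤ_[p] (valuationRing p L)) := by
  have h : Function.Injective (algebraMap ℤ_[p] L) :=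
    (algebraMap ℚ_[p] L).injective.comp (IsFractionRing.injective ℤ_[p] ℚ_[p])
  rw [IsScalarTower.algebraMap_eq ℤ_[p] (valuationRing p L) L, RingHom.coe_comp] at h
  exact Function.Injective.of_comp h

section Finite

variable [FiniteDimensional ℚ_[p] L]

instance : Module.Finite ℤ_[p] (valuationRing p L) :=
  IsIntegralClosure.finite ℤ_[p] ℚ_[p] L (valuationRing p L)

instance : IsDiscreteValuationRing (valuationRing p L) := by
  have : IsDedekindDomain (valuationRing p L) :=
    IsIntegralClosure.isDedekindDomain ℤ_[p] ℚ_[p] L (valuationRing p L)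
  have hf : ¬ IsField (valuationRing p L) := fun h => by
    have h1 := p_mem_maximalIdeal p L
    rw [isField_iff_maximalIdeal_eq.mp h] at h1
    exact p_ne_zero_valuationRing p L h1
  exact ((IsDiscreteValuationRing.TFAE (valuationRing p L) hf).out 0 2).mpr this

instance : Finite (ResidueField ℤ_[p]) := Finite.of_equiv _ PadicInt.residueField.symm.toEquiv

instance : IsLocalHom (algebraMap ℤ_[p] (valuationRing p L)) :=
  have : FaithfulSMul ℤ_[p] (valuationRing p L) := (faithfulSMul_iff_algebraMap_injective _ _).mpr
    (algebraMap_valuationRing_injective p L)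
  Algebra.IsIntegral.isLocalHom _ _

instance : Finite (ResidueField (valuationRing p L)) :=
  Module.finite_of_finite (ResidueField ℤ_[p])

end Finite

noncomputable instance : MulSemiringAction Gal(L/ℚ_[p]) (valuationRing p L) where
  smul g x := ⟨g x, (spectralNorm_eq_of_equiv g (x : L)).symm.le.trans x.2⟩
  one_smul _ := rfl
  mul_smul _ _ _ := rfl
  smul_zero g := Subtype.ext (map_zero g)
  smul_add g x y := Subtype.ext (map_add g x.1 y.1)
  smul_one g := Subtype.ext (map_one g)
  smul_mul g x y := Subtype.ext (map_mul g x.1 y.1)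

theorem coe_smul_valuationRing (g : Gal(L/ℚ_[p])) (x : valuationRing p L) :
    ((g • x : valuationRing p L) : L) = g x := rfl

theorem isGaloisGroup_valuationRing [FiniteDimensional ℚ_[p] L] [IsGalois ℚ_[p] L] :
    IsGaloisGroup Gal(L/ℚ_[p]) ℤ_[p] (valuationRing p L) := by
  have : IsFractionRing (valuationRing p L) L := inferInstance
  have : SMulDistribClass Gal(L/ℚ_[p]) (valuationRing p L) L :=
    ⟨fun g x y => map_mul g (x : L) y⟩
  exact IsGaloisGroup.of_isFractionRing _ _ _ ℚ_[p] L

end ValuationRing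


open IsLocalRing Polynomial

/-! ### Automorphisms of finite fields and cyclic groups -/

section FiniteFields

theorem exists_eq_pow_of_ringAut (p : ℕ) [Fact p.Prime] (k : Type*) [Field k] [Finite k] [CharP k p]
    (σ : RingAut k) : ∃ j : ℕ, ∀ x, σ x = x ^ p ^ j := by
  let : Algebra (ZMod p) k := ZMod.algebra k p
  let τ : k ≃ₐ[ZMod p] k := AlgEquiv.ofRingEquiv (f := σ)
    fun r => congrArg (fun f : ZMod p →+* k => f r) (Subsingleton.elim
      ((RingEquiv.toRingHom σ).comp (algebraMap (ZMod p) k)) (algebraMap (ZMod p) k))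
  obtain ⟨n, hn⟩ := (FiniteField.bijective_frobeniusAlgEquivOfAlgebraic_pow (ZMod p) k).2 τ
  refine ⟨n, fun x => ?_⟩
  have h := congrArg (fun f : k ≃ₐ[ZMod p] k => f x) hn
  rw [show σ x = τ x from rfl, ← h]
  simp [FiniteField.coe_frobeniusAlgEquivOfAlgebraic_iterate, AlgEquiv.coe_pow]

instance (k : Type*) [Field k] [Finite k] : IsCyclic (RingAut k) := by
  obtain ⟨p, hp⟩ := CharP.exists k
  have : Fact p.Prime := ⟨CharP.char_is_prime k p⟩
  refine ⟨frobeniusEquiv k p, fun σ => ?_⟩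
  obtain ⟨j, hj⟩ := exists_eq_pow_of_ringAut p k σ
  refine ⟨j, RingEquiv.ext fun x => ?_⟩
  rw [hj]
  simp only [zpow_natCast]
  clear hj
  induction j with
  | zero => simp
  | succ n ih => 
    rw [pow_succ', RingAut.mul_apply, ih, frobeniusEquiv_def, ← pow_mul, ← pow_succ]

/-- Divide the exponents of a and b by their gcd and cross them. Coprimality keeps the relation
nontrivial modulo every prime. -/
theorem exists_isCoprime_zpow_mul_zpow_eq_one {A : Type*} [Group A] [IsCyclic A] (a b : A) :
    ∃ u v : ℤ, IsCoprime u v ∧ a ^ u * b ^ v = 1 := by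
  obtain ⟨g, hg⟩ := IsCyclic.exists_generator (α := A)
  obtain ⟨m, rfl⟩ := hg a
  obtain ⟨n, rfl⟩ := hg b
  by_cases h : Int.gcd m n = 0
  · obtain ⟨rfl, rfl⟩ := Int.gcd_eq_zero_iff.mp h
    exact ⟨1, 0, isCoprime_one_left, by simp⟩
  · obtain ⟨m', n', hc, hm, hn⟩ := Int.exists_gcd_one (Nat.pos_of_ne_zero h)
    refine ⟨n', -m', (Int.isCoprime_iff_gcd_eq_one.mpr hc).symm.neg_right, ?_⟩
    simp only [← zpow_mul, ← zpow_add]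
    rw [show m * n' + n * -m' = 0 by linear_combination n' * hm - m' * hn, zpow_zero]

end FiniteFields

/-! ### Inertia, the tame character and wild inertia -/

section Inertia

variable (p : ℕ) [Fact p.Prime] (L : Type*) [Field L] [Algebra ℚ_[p] L]
  [FiniteDimensional ℚ_[p] L]

/-- The inertia group: the automorphisms that act trivially on the residue field. -/
noncomputable def inertiaGroup : Subgroup Gal(L/ℚ_[p]) :=
  (MulSemiringAction.toRingAut Gal(L/ℚ_[p]) (ResidueField (valuationRing p L))).ker

variable {L} in
/-- `g` acts on the residue field as the `j`-th power of the absolute Frobenius. -/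
def ActsAsFrobPow (g : Gal(L/ℚ_[p])) (j : ℕ) : Prop :=
  ∀ z : ResidueField (valuationRing p L), g • z = z ^ p ^ j

variable {p L}

theorem mem_inertiaGroup {g : Gal(L/ℚ_[p])} :
    g ∈ inertiaGroup p L ↔ ∀ z : ResidueField (valuationRing p L), g • z = z :=
  ⟨fun h z => congrArg (fun f : RingAut _ => f z) h, fun h => RingEquiv.ext h⟩

theorem exists_zpow_mul_zpow_mem_inertiaGroup (a b : Gal(L/ℚ_[p])) :
    ∃ u v : ℤ, IsCoprime u v ∧ a ^ u * b ^ v ∈ inertiaGroup p L := by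
  obtain ⟨u, v, h, e⟩ := exists_isCoprime_zpow_mul_zpow_eq_one
    (MulSemiringAction.toRingAut Gal(L/ℚ_[p]) (ResidueField (valuationRing p L)) a)
    (MulSemiringAction.toRingAut Gal(L/ℚ_[p]) (ResidueField (valuationRing p L)) b)
  exact ⟨u, v, h, by rw [inertiaGroup, MonoidHom.mem_ker, map_mul, map_zpow, map_zpow, e]⟩

theorem commutator_mem_inertiaGroup (a b : Gal(L/ℚ_[p])) :
    a * b * a⁻¹ * b⁻¹ ∈ inertiaGroup p L := by
  rw [inertiaGroup, MonoidHom.mem_ker, map_mul, map_mul, map_mul, map_inv, map_inv,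
    mul_inv_eq_one, mul_inv_eq_iff_eq_mul]
  exact IsCyclic.commGroup.mul_comm _ _

theorem exists_actsAsFrobPow (g : Gal(L/ℚ_[p])) : ∃ j, ActsAsFrobPow p g j :=
  exists_eq_pow_of_ringAut p (ResidueField (valuationRing p L))
    (MulSemiringAction.toRingAut Gal(L/ℚ_[p]) _ g)

theorem ActsAsFrobPow.mul {g h : Gal(L/ℚ_[p])} {i j : ℕ} (hg : ActsAsFrobPow p g i)
    (hh : ActsAsFrobPow p h j) : ActsAsFrobPow p (g * h) (j + i) := fun z => by
  rw [mul_smul, hh, hg, ← pow_mul, ← pow_add]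

variable (p L) in
theorem exists_mem_inertiaGroup_of_dvd : ∃ f : ℕ, 0 < f ∧
    ∀ (g : Gal(L/ℚ_[p])) (j : ℕ), ActsAsFrobPow p g j → f ∣ j → g ∈ inertiaGroup p L := by
  have := Fintype.ofFinite (ResidueField (valuationRing p L))
  obtain ⟨f, hp, hf⟩ := FiniteField.card (ResidueField (valuationRing p L)) p
  refine ⟨f, f.pos, fun g j hg ⟨i, hi⟩ => mem_inertiaGroup.mpr fun z => ?_⟩
  rw [hg, hi, pow_mul, ← hf, FiniteField.pow_card_pow]

theorem actsAsFrobPow_iff {g : Gal(L/ℚ_[p])} {j : ℕ} : ActsAsFrobPow p g j ↔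
    ∀ x : L, spectralNorm ℚ_[p] L x ≤ 1 → spectralNorm ℚ_[p] L (g x - x ^ p ^ j) < 1 := by
  have key (x : valuationRing p L) : g • residue _ x = residue _ x ^ p ^ j ↔
      spectralNorm ℚ_[p] L (g x - (x : L) ^ p ^ j) < 1 := by
    rw [← map_pow, ← ResidueField.residue_smul, ← sub_eq_zero, ← map_sub, residue_eq_zero_iff,
      mem_maximalIdeal_valuationRing]
    rfl
  constructor
  · exact fun h x hx => (key ⟨x, hx⟩).mp (h _)
  · intro h z
    obtain ⟨x, rfl⟩ := residue_surjective z
    exact (key x).mpr (h x x.2)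

/-- The integer `g x / x`. -/
noncomputable def ratio (g : Gal(L/ℚ_[p])) (x : L) : valuationRing p L :=
  ⟨g x / x, by
    rw [mem_valuationRing, specNorm_div, ← spectralNorm_eq_of_equiv g x]
    exact div_self_le_one _⟩

theorem ratio_mul_right (g : Gal(L/ℚ_[p])) (x y : L) : ratio g (x * y) = ratio g x * ratio g y :=
  Subtype.ext <| by simp [ratio, mul_div_mul_comm]

theorem ratio_mul_left (g h : Gal(L/ℚ_[p])) {x : L} (hx : x ≠ 0) :
    ratio (g * h) x = g • ratio h x * ratio g x :=
  Subtype.ext <| by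
    have : g x ≠ 0 := by simpa
    simp [ratio, coe_smul_valuationRing]
    field_simp

theorem residue_ratio_eq_one {g : Gal(L/ℚ_[p])} (hg : g ∈ inertiaGroup p L) {x : L}
    (hx : spectralNorm ℚ_[p] L x = 1) : residue _ (ratio g x) = 1 := by
  have h0 : x ≠ 0 := by
    rintro rfl
    simp [spectralNorm_zero] at hx
  have h := actsAsFrobPow_iff.mp (show ActsAsFrobPow p g 0 by
    simpa [ActsAsFrobPow] using mem_inertiaGroup.mp hg) x hx.le
  rw [← map_one (residue _), ← sub_eq_zero, ← map_sub, residue_eq_zero_iff,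
    mem_maximalIdeal_valuationRing]
  rw [pow_zero, pow_one] at h
  have e : ((ratio g x - 1 : valuationRing p L) : L) = (g x - x) / x := by
    simp [ratio, sub_div, h0]
  rwa [e, specNorm_div, hx, div_one]

/-- The tame character `c ↦ c π / π` of the inertia group. -/
noncomputable def tameCharacter (ϖ : Lˣ) :
    inertiaGroup p L →* (ResidueField (valuationRing p L))ˣ :=
  MonoidHom.toHomUnits
    { toFun c := residue _ (ratio (c : Gal(L/ℚ_[p])) (ϖ : L))
      map_one' := by
        rw [← map_one (residue _)]
        congr 1
        exact Subtype.ext (by simp [ratio])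
      -- The ratio is a cocycle; its residue is multiplicative because inertia acts trivially on the
      -- residue field.
      map_mul' c d := by
        rw [Subgroup.coe_mul, ratio_mul_left _ _ ϖ.ne_zero, map_mul, ResidueField.residue_smul,
          mem_inertiaGroup.mp c.2, mul_comm] }

theorem coe_tameCharacter (ϖ : Lˣ) (c : inertiaGroup p L) :
    (tameCharacter ϖ c : ResidueField (valuationRing p L)) =
      residue _ (ratio (c : Gal(L/ℚ_[p])) (ϖ : L)) := rfl

variable (p L) in
theorem exists_irreducible_units : ∃ ϖ : Lˣ, ∃ π : valuationRing p L, Irreducible π ∧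
    (π : L) = ϖ := by
  obtain ⟨π, hπ⟩ := IsDiscreteValuationRing.exists_irreducible (valuationRing p L)
  have : (π : L) ≠ 0 := fun h => hπ.ne_zero (Subtype.ext h)
  exact ⟨Units.mk0 π this, π, hπ, rfl⟩

variable (p L) in
/-- A uniformizer. -/
noncomputable def uniformizer : Lˣ := (exists_irreducible_units p L).choose

variable (p L) in
/-- The wild inertia group: the kernel of the tame character. -/
noncomputable def wildInertia : Subgroup Gal(L/ℚ_[p]) :=
  (tameCharacter (uniformizer p L)).ker.map (inertiaGroup p L).subtype

theorem mem_wildInertia {w : Gal(L/ℚ_[p])} : w ∈ wildInertia p L ↔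
    ∃ h : w ∈ inertiaGroup p L, tameCharacter (uniformizer p L) ⟨w, h⟩ = 1 := by
  simp [wildInertia]

theorem exists_zpow_mul_zpow_mem_wildInertia {c d : Gal(L/ℚ_[p])} (hc : c ∈ inertiaGroup p L)
    (hd : d ∈ inertiaGroup p L) :
    ∃ u v : ℤ, IsCoprime u v ∧ c ^ u * d ^ v ∈ wildInertia p L := by
  obtain ⟨u, v, h, e⟩ := exists_isCoprime_zpow_mul_zpow_eq_one
    (tameCharacter (uniformizer p L) ⟨c, hc⟩) (tameCharacter (uniformizer p L) ⟨d, hd⟩)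
  refine ⟨u, v, h, mem_wildInertia.mpr ⟨mul_mem (zpow_mem hc u) (zpow_mem hd v), ?_⟩⟩
  rwa [← map_zpow, ← map_zpow, ← map_mul] at e

/-- Conjugation replaces ϖ by g⁻¹ϖ, a unit multiple of ϖ, which leaves the residue of the ratio
unchanged; g then raises that residue to the power p^j. -/
theorem conj_mul_inv_pow_mem_wildInertia {g c : Gal(L/ℚ_[p])} {j : ℕ} (hg : ActsAsFrobPow p g j)
    (hc : c ∈ inertiaGroup p L) : g * c * g⁻¹ * (c ^ p ^ j)⁻¹ ∈ wildInertia p L := by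
  have hI : g * c * g⁻¹ ∈ inertiaGroup p L := (MonoidHom.normal_ker _).conj_mem c hc g
  refine mem_wildInertia.mpr ⟨mul_mem hI (inv_mem (pow_mem hc _)), ?_⟩
  set ϖ := uniformizer p L
  suffices h : tameCharacter ϖ ⟨g * c * g⁻¹, hI⟩ = tameCharacter ϖ ⟨c, hc⟩ ^ p ^ j by
    rw [← map_pow, ← mul_inv_eq_one, ← map_inv, ← map_mul] at h
    exact h
  refine Units.ext ?_
  rw [Units.val_pow_eq_pow_val, coe_tameCharacter, coe_tameCharacter]
  set y := g⁻¹ (ϖ : L)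
  have hy : spectralNorm ℚ_[p] L (y / ϖ) = 1 := by
    rw [specNorm_div, ← spectralNorm_eq_of_equiv g⁻¹ (ϖ : L)]
    exact div_self (specNorm_pos p ϖ.ne_zero).ne'
  have e1 : ratio (g * c * g⁻¹) (ϖ : L) = g • ratio c y := by
    refine Subtype.ext ?_
    simp only [ratio, coe_smul_valuationRing, map_div₀]
    congr 1
    exact (AlgEquiv.apply_symm_apply g (ϖ : L)).symm
  have e2 : y = ϖ * (y / ϖ) := by field_simp
  rw [e1, e2, ratio_mul_right, ResidueField.residue_smul, map_mul, residue_ratio_eq_one hc hy,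
    mul_one, hg]

/-- The residue of w x / x is multiplicative in x, trivial on units (inertia) and on the uniformizer
(wildness). -/
theorem residue_ratio_of_mem_wildInertia {w : Gal(L/ℚ_[p])} (hw : w ∈ wildInertia p L) {x : L}
    (hx : x ≠ 0) : residue _ (ratio w x) = 1 := by
  obtain ⟨hI, hw⟩ := mem_wildInertia.mp hw
  obtain ⟨π, hπ, e⟩ := (exists_irreducible_units p L).choose_spec
  have h1 : residue _ (ratio w (π : L)) = 1 := by
    rw [e]
    exact congrArg Units.val hw
  let r : L →* ResidueField (valuationRing p L) :=
    { toFun x := residue _ (ratio w x)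
      map_one' := residue_ratio_eq_one hI spectralNorm_one
      map_mul' x y := by rw [ratio_mul_right, map_mul] }
  have hint (x : valuationRing p L) (h : x ≠ 0) : r x = 1 := by
    obtain ⟨n, u, hu⟩ := IsDiscreteValuationRing.eq_unit_mul_pow_irreducible h hπ
    have h2 : spectralNorm ℚ_[p] L ((u : valuationRing p L) : L) = 1 := by
      refine le_antisymm u.1.2 (not_lt.mp fun h => ?_)
      exact (mem_maximalIdeal_valuationRing p L).mpr h u.isUnit
    rw [hu]
    push_cast
    rw [map_mul, map_pow, show r (π : L) = 1 from h1, one_pow, mul_one]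
    exact residue_ratio_eq_one hI h2
  rcases (valuationRing p L).mem_or_inv_mem x with h | h
  · exact hint ⟨x, h⟩ (fun h => hx (congrArg Subtype.val h))
  · have h2 : r x⁻¹ = 1 := hint ⟨x⁻¹, h⟩ (fun h => hx (inv_eq_zero.mp (congrArg Subtype.val h)))
    have h3 : r x * r x⁻¹ = 1 := by rw [← map_mul, mul_inv_cancel₀ hx, map_one]
    rwa [h2, mul_one] at h3

/-- The orbit sum s of x is fixed by w, and y = m x - s has orbit sum 0. If y ≠ 0, dividing that sum
by y and reducing turns each term into 1, so m = 0 in the residue field. -/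
theorem eq_one_of_mem_wildInertia {w : Gal(L/ℚ_[p])} (hw : w ∈ wildInertia p L) {m : ℕ}
    (hm : ¬ p ∣ m) (h1 : w ^ m = 1) : w = 1 := by
  have hm0 : (m : L) ≠ 0 := by
    have : CharZero L := charZero_of_injective_algebraMap (algebraMap ℚ_[p] L).injective
    rintro h
    exact hm (by simp [Nat.cast_eq_zero.mp h])
  have hfix (x : L) : w (∑ i ∈ Finset.range m, (w ^ i) x) = ∑ i ∈ Finset.range m, (w ^ i) x := by
    rw [map_sum]
    have h := Finset.sum_range_succ' (fun i => (w ^ i) x) m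
    rw [Finset.sum_range_succ, h1, pow_zero] at h
    rw [add_right_cancel h]
    simp [pow_succ', AlgEquiv.mul_apply]
  refine AlgEquiv.ext fun x => ?_
  set s := ∑ i ∈ Finset.range m, (w ^ i) x
  have hs (i : ℕ) : (w ^ i) s = s := by
    induction i with
    | zero => rfl
    | succ n ih => rw [pow_succ', AlgEquiv.mul_apply, ih, hfix]
  have hy : (m : L) * x - s = 0 := by
    by_contra hy
    have h2 : ∑ i ∈ Finset.range m, ratio (w ^ i) (m * x - s) = 0 := by
      refine Subtype.ext ?_
      push_cast
      simp only [ratio]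
      rw [← Finset.sum_div]
      simp only [map_sub, map_mul, map_natCast, hs, Finset.sum_sub_distrib, ← Finset.mul_sum]
      simp [s]
    have h3 := congrArg (residue _) h2
    rw [map_sum, Finset.sum_congr rfl
      fun i _ => residue_ratio_of_mem_wildInertia (pow_mem hw i) hy] at h3
    simp only [Finset.sum_const, Finset.card_range, nsmul_eq_mul, mul_one, map_zero] at h3
    exact hm ((CharP.cast_eq_zero_iff _ p m).mp h3)
  have h4 : (m : L) * w x = m * x := by
    conv_lhs => rw [← map_natCast w m, ← map_mul, sub_eq_zero.mp hy, hfix]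
    exact (sub_eq_zero.mp hy).symm
  exact mul_left_cancel₀ hm0 h4

theorem exists_pow_eq_one_of_mem_wildInertia {w : Gal(L/ℚ_[p])} (hw : w ∈ wildInertia p L) :
    ∃ r : ℕ, w ^ p ^ r = 1 := by
  obtain ⟨r, m, hm, e⟩ := Nat.exists_eq_pow_mul_and_not_dvd (orderOf_pos w).ne' p
    (Fact.out : p.Prime).ne_one
  refine ⟨r, eq_one_of_mem_wildInertia (pow_mem hw _) hm ?_⟩
  rw [← pow_mul, ← e, pow_orderOf_eq_one]

end Inertia


/-! ### Inertia and Frobenius exponents at a finite level -/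

section Levels

variable {q : ℕ} [Fact q.Prime] {F' : Type*} [Field F'] [Algebra ℚ_[q] F']
  [FiniteDimensional ℚ_[q] F'] {Ξ' : Type*} [Field Ξ'] [Algebra F' Ξ']
  [Algebra ℚ_[q] Ξ'] [IsScalarTower ℚ_[q] F' Ξ']

theorem finiteDimensional_padic_level (E : IntermediateField F' Ξ') [FiniteDimensional F' E] :
    FiniteDimensional ℚ_[q] E := FiniteDimensional.trans ℚ_[q] F' E

attribute [local instance] finiteDimensional_padic_level

variable (q) in
/-- Restriction of automorphisms to a finite normal subextension. -/
noncomputable def restrictLevel (E : IntermediateField F' Ξ') [Normal F' E] :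
    Gal(Ξ'/F') →* Gal(E/ℚ_[q]) :=
  (AlgEquiv.restrictScalarsHom ℚ_[q]).comp (AlgEquiv.restrictNormalHom E)

omit [FiniteDimensional ℚ_[q] F'] in
theorem coe_restrictLevel (E : IntermediateField F' Ξ') [Normal F' E] (g : Gal(Ξ'/F')) (x : E) :
    ((restrictLevel q E g x : E) : Ξ') = g x :=
  AlgEquiv.restrictNormal_commutes g E x

omit [FiniteDimensional ℚ_[q] F'] in
theorem mem_fixingSubgroup_of_restrictLevel_eq_one {E : IntermediateField F' Ξ'} [Normal F' E]
    {g : Gal(Ξ'/F')} (h : restrictLevel q E g = 1) : g ∈ E.fixingSubgroup := by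
  rw [IntermediateField.mem_fixingSubgroup_iff]
  intro x hx
  have := coe_restrictLevel (q := q) E g ⟨x, hx⟩
  rw [h] at this
  exact this.symm

variable (E : IntermediateField F' Ξ') [FiniteDimensional F' E] [Normal F' E]

variable (q) in
/-- The automorphisms that restrict to elements of the inertia group of `E`. -/
noncomputable def inertiaAt : Subgroup Gal(Ξ'/F') := (inertiaGroup q E).comap (restrictLevel q E)

variable (q) in
/-- The automorphisms that restrict to elements of the wild inertia group of `E`. -/
noncomputable def wildAt : Subgroup Gal(Ξ'/F') := (wildInertia q E).comap (restrictLevel q E)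

variable (q) in
/-- `g` acts on the residue field of `E` as the `j`-th power of the absolute Frobenius. -/
def FrobOn (g : Gal(Ξ'/F')) (j : ℕ) : Prop := ActsAsFrobPow q (restrictLevel q E g) j

variable (q) in
theorem exists_zpow_mul_zpow_mem_inertiaAt (a b : Gal(Ξ'/F')) :
    ∃ u v : ℤ, IsCoprime u v ∧ a ^ u * b ^ v ∈ inertiaAt q E := by
  simp only [inertiaAt, Subgroup.mem_comap, map_mul, map_zpow]
  exact exists_zpow_mul_zpow_mem_inertiaGroup _ _

variable {E}

theorem exists_zpow_mul_zpow_mem_wildAt {c d : Gal(Ξ'/F')} (hc : c ∈ inertiaAt q E)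
    (hd : d ∈ inertiaAt q E) : ∃ u v : ℤ, IsCoprime u v ∧ c ^ u * d ^ v ∈ wildAt q E := by
  simp only [wildAt, Subgroup.mem_comap, map_mul, map_zpow]
  exact exists_zpow_mul_zpow_mem_wildInertia hc hd

theorem exists_pow_mem_fixingSubgroup {w : Gal(Ξ'/F')} (hw : w ∈ wildAt q E) :
    ∃ r : ℕ, w ^ q ^ r ∈ E.fixingSubgroup := by
  obtain ⟨r, hr⟩ := exists_pow_eq_one_of_mem_wildInertia hw
  exact ⟨r, mem_fixingSubgroup_of_restrictLevel_eq_one (q := q) (by rw [map_pow, hr])⟩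

variable (E) in
theorem commutator_mem_inertiaAt (a b : Gal(Ξ'/F')) : a * b * a⁻¹ * b⁻¹ ∈ inertiaAt q E := by
  simp only [inertiaAt, Subgroup.mem_comap, map_mul, map_inv]
  exact commutator_mem_inertiaGroup _ _

variable (q E) in
theorem exists_frobOn (g : Gal(Ξ'/F')) : ∃ j, FrobOn q E g j := exists_actsAsFrobPow _

theorem FrobOn.pow {g : Gal(Ξ'/F')} {j : ℕ} (h : FrobOn q E g j) (n : ℕ) :
    FrobOn q E (g ^ n) (n * j) := by
  induction n with
  | zero =>
    intro z
    simp
  | succ n ih =>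
    rw [pow_succ', add_one_mul]
    have := ActsAsFrobPow.mul h ih
    rwa [← map_mul] at this

theorem conj_mul_inv_pow_mem_wildAt {g c : Gal(Ξ'/F')} {j : ℕ} (hg : FrobOn q E g j)
    (hc : c ∈ inertiaAt q E) : g * c * g⁻¹ * (c ^ q ^ j)⁻¹ ∈ wildAt q E := by
  simp only [wildAt, Subgroup.mem_comap, map_mul, map_inv, map_pow]
  exact conj_mul_inv_pow_mem_wildInertia hg hc

variable (q E) in
theorem exists_mem_inertiaAt_of_dvd : ∃ f : ℕ, 0 < f ∧
    ∀ (g : Gal(Ξ'/F')) (j : ℕ), FrobOn q E g j → f ∣ j → g ∈ inertiaAt q E := by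
  obtain ⟨f, hf, h⟩ := exists_mem_inertiaGroup_of_dvd q E
  exact ⟨f, hf, fun g j => h _ j⟩

/-- The norm is taken in Ξ', so the same exponent serves every smaller level. -/
theorem frobOn_iff {g : Gal(Ξ'/F')} {j : ℕ} : FrobOn q E g j ↔
    ∀ x ∈ E, spectralNorm ℚ_[q] Ξ' x ≤ 1 → spectralNorm ℚ_[q] Ξ' (g x - x ^ q ^ j) < 1 := by
  rw [FrobOn, actsAsFrobPow_iff]
  have : IsScalarTower ℚ_[q] E Ξ' := .of_algebraMap_eq fun x => by
    rw [IsScalarTower.algebraMap_apply ℚ_[q] F' E, IsScalarTower.algebraMap_apply ℚ_[q] F' Ξ']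
    rfl
  have key (x : E) : spectralNorm ℚ_[q] Ξ' (x : Ξ') = spectralNorm ℚ_[q] E x :=
    (spectralNorm.eq_of_tower (K := ℚ_[q]) (L := Ξ') x).symm
  simp only [← key]
  push_cast [coe_restrictLevel]
  exact ⟨fun h x hx => h ⟨x, hx⟩, fun h x => h x x.2⟩

theorem FrobOn.of_le {E' : IntermediateField F' Ξ'} [FiniteDimensional F' E'] [Normal F' E']
    (hE : E ≤ E') {g : Gal(Ξ'/F')} {j : ℕ} (h : FrobOn q E' g j) : FrobOn q E g j :=
  frobOn_iff.mpr fun x hx => frobOn_iff.mp h x (hE hx)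

end Levels

/-! ### Transfer of open conditions to a finite level -/

section Compactness

open Topology

theorem exists_level_of_isOpen {F Ξ F' Ξ' : Type*} [Field F] [Field Ξ] [Algebra F Ξ] [IsGalois F Ξ]
    [Field F'] [Field Ξ'] [Algebra F' Ξ'] [IsGalois F' Ξ'] (α : Gal(Ξ/F) →ₜ* Gal(Ξ'/F'))
    (hα : Function.Injective α) (U : Set Gal(Ξ/F)) (hU : IsOpen U) (h1 : 1 ∈ U) :
    ∃ E : IntermediateField F' Ξ', FiniteDimensional F' E ∧ Normal F' E ∧
      ∀ h, α h ∈ E.fixingSubgroup → h ∈ U := by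
  have : CompactSpace Gal(Ξ/F) := inferInstance
  have hc : IsClosedEmbedding α := α.continuous_toFun.isClosedEmbedding hα
  have h2 : U ∈ 𝓝 (1 : Gal(Ξ/F)) := hU.mem_nhds h1
  rw [hc.isInducing.nhds_eq_comap, map_one, Filter.mem_comap] at h2
  obtain ⟨V, hV, hVU⟩ := h2
  obtain ⟨E, hf, hn, hE⟩ := (krullTopology_mem_nhds_one_iff_of_normal F' Ξ' V).mp hV
  exact ⟨E, hf, hn, fun h hh => hVU (hE hh)⟩

end Compactness


/-! ### Powers of q modulo powers of p and modulo q^k - 1 -/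

section Arithmetic

theorem pow_dvd_of_pow_dvd_pow_sub_one {p q : ℕ} (hp : p.Prime) (hq : q.Prime) (hpq : p ≠ q)
    (r : ℕ) : ∃ n : ℕ, ∀ j : ℕ, (p : ℤ) ^ n ∣ (q : ℤ) ^ j - 1 → p ^ r ∣ j := by
  obtain _ | r := r
  · exact ⟨0, fun j _ => by simp⟩
  set e := p ^ r * (p - 1)
  have he : 0 < e := Nat.mul_pos (pow_pos hp.pos _) (Nat.sub_pos_of_lt hp.one_lt)
  -- This makes p^n > q^e, so the order of q modulo p^n cannot divide e. As it divides p^(n-1)(p-1),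
  -- it is divisible by p^(r+1).
  refine ⟨q ^ e + 1, fun j hj => ?_⟩
  set n := q ^ e + 1
  have hcop : Nat.Coprime q (p ^ n) := (hq.coprime_iff_not_dvd.mpr fun h =>
    hpq ((Nat.prime_dvd_prime_iff_eq hq hp).mp (hq.dvd_of_dvd_pow h)).symm)
  set u := ZMod.unitOfCoprime q hcop
  have hu (i : ℕ) : u ^ i = 1 ↔ (p : ℤ) ^ n ∣ (q : ℤ) ^ i - 1 := by
    rw [← Units.val_inj, Units.val_pow_eq_pow_val, ZMod.coe_unitOfCoprime, Units.val_one,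
      ← sub_eq_zero]
    have := ZMod.intCast_zmod_eq_zero_iff_dvd ((q : ℤ) ^ i - 1) (p ^ n)
    push_cast at this
    rw [← this]
  by_contra hdvd
  have h1 : orderOf u ∣ j := orderOf_dvd_of_pow_eq_one ((hu j).mpr hj)
  have h2 : orderOf u ∣ p ^ (n - 1) * (p - 1) := by
    rw [← Nat.totient_prime_pow hp (Nat.succ_pos _)]
    exact orderOf_dvd_of_pow_eq_one (ZMod.pow_totient u)
  have h3 : orderOf u ∣ e := by
    have hc : Nat.Coprime (p ^ (n - 1)) (p - 1) :=
      Nat.Coprime.pow_left _ ((Nat.coprime_self_sub_right hp.one_le).mpr (by simp))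
    obtain ⟨a, b, ha, hb, hab⟩ := exists_dvd_and_dvd_of_dvd_mul h2
    obtain ⟨i, hi, rfl⟩ := (Nat.dvd_prime_pow hp).mp ha
    rw [hab]
    refine mul_dvd_mul (pow_dvd_pow _ ?_) hb
    by_contra hlt
    exact hdvd ((pow_dvd_pow p (by omega)).trans ((Dvd.intro _ hab.symm).trans h1))
  have h4 := (hu e).mp (orderOf_dvd_iff_pow_eq_one.mp h3)
  have h5 : 1 < (q : ℤ) ^ e := one_lt_pow₀ (by exact_mod_cast hq.one_lt) he.ne'
  have h6 := Int.le_of_dvd (by linarith) h4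
  have h7 : n < p ^ n := Nat.lt_pow_self hp.one_lt
  zify at h7
  simp only [n] at h6 h7
  push_cast at h6 h7
  linarith

/-- Reduce j to i < k. Either A and B q^i, or A q^(k-i) and B, are both below the modulus, where
congruence means equality. -/
theorem not_pow_sub_one_dvd {q : ℕ} (hq : 1 < q) {A B : ℕ} (hA : 0 < A) (hB : 0 < B)
    (hAB : ∀ i, A ≠ B * q ^ i ∧ A * q ^ i ≠ B) : ∃ K, ∀ k ≥ K, ∀ j : ℕ,
      ¬ (q : ℤ) ^ k - 1 ∣ A - B * (q : ℤ) ^ j := by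
  refine ⟨A + B + 1, fun k hk j hdvd => ?_⟩
  have hqA : A < q ^ A := Nat.lt_pow_self hq
  have hqB : B < q ^ B := Nat.lt_pow_self hq
  have hq0 : 0 < q := by omega
  have hm {x e : ℕ} (hx : x < q ^ e) (he : e < k) : (x : ℤ) < (q : ℤ) ^ k - 1 := by
    have h1 : q ^ (e + 1) ≤ q ^ k := Nat.pow_le_pow_right hq0 he
    rw [pow_succ] at h1
    have h2 : q ^ e * 2 ≤ q ^ e * q := Nat.mul_le_mul_left _ hq
    have h3 : x + 1 < q ^ k := by omega
    zify at h3
    linarith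
  have heq {x y : ℕ} (hx : (x : ℤ) < (q : ℤ) ^ k - 1) (hy : (y : ℤ) < (q : ℤ) ^ k - 1)
      (h : (q : ℤ) ^ k - 1 ∣ x - y) : x = y := by
    have := Int.eq_zero_of_abs_lt_dvd h (abs_lt.mpr ⟨by linarith, by linarith⟩)
    exact_mod_cast sub_eq_zero.mp this
  have hred : (q : ℤ) ^ k - 1 ∣ A - B * (q : ℤ) ^ (j % k) := by
    have h1 : (q : ℤ) ^ k - 1 ∣ (q : ℤ) ^ j - (q : ℤ) ^ (j % k) := by
      have h2 := sub_one_dvd_pow_sub_one ((q : ℤ) ^ k) (j / k)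
      have h3 : (q : ℤ) ^ j = (q : ℤ) ^ (j % k) * ((q : ℤ) ^ k) ^ (j / k) := by
        rw [← pow_mul, ← pow_add, Nat.mod_add_div]
      rw [h3, show ∀ a b : ℤ, a * b - a = a * (b - 1) by intros; ring]
      exact h2.mul_left _
    have := hdvd.add (h1.mul_left (B : ℤ))
    ring_nf at this ⊢
    exact this
  have hj : j % k < k := Nat.mod_lt _ (by omega)
  set i := j % k
  by_cases hi : i + B < k
  · refine (hAB i).1 (heq (hm hqA (by omega)) (hm (e := i + B) ?_ hi) (by push_cast; exact hred))
    rw [pow_add, mul_comm]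
    exact Nat.mul_lt_mul_of_pos_left hqB (pow_pos hq0 _)
  · refine (hAB (k - i)).2 (heq (hm (e := A + B) ?_ (by omega)) (hm hqB (by omega)) ?_)
    · rw [pow_add]
      exact Nat.mul_lt_mul_of_lt_of_le hqA (Nat.pow_le_pow_right hq0 (by omega)) (pow_pos hq0 _)
    · have h1 := (hred.mul_right ((q : ℤ) ^ (k - i))).add (dvd_mul_left ((q : ℤ) ^ k - 1) (B : ℤ))
      have h2 : (q : ℤ) ^ i * (q : ℤ) ^ (k - i) = (q : ℤ) ^ k := by
        rw [← pow_add, Nat.add_sub_cancel' hj.le]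
      have h3 : ((A * q ^ (k - i) : ℕ) : ℤ) - B =
          (A - B * (q : ℤ) ^ i) * (q : ℤ) ^ (k - i) + B * ((q : ℤ) ^ k - 1) := by
        push_cast
        linear_combination (B : ℤ) * h2
      rwa [h3]

/-- M is (q^k - 1)/p^c for large k, where p^c is the exact power of p in q - 1. -/
theorem exists_modulus {p q : ℕ} (hp : p.Prime) (hq : q.Prime) (hpq : p ≠ q) {N C : ℕ}
    (hN : 0 < N) (hC : 0 < C) : ∃ M : ℕ, 0 < M ∧ ¬ p ∣ M ∧ ¬ q ∣ M ∧
      ∀ j : ℕ, ¬ (M : ℤ) ∣ C * ((p : ℤ) ^ N - (q : ℤ) ^ j) := by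
  obtain ⟨c, m, hm, e⟩ := Nat.exists_eq_pow_mul_and_not_dvd
    (Nat.sub_pos_of_lt hq.one_lt).ne' p hp.ne_one
  have hpq' : ¬ p ∣ q := fun h => hpq ((Nat.prime_dvd_prime_iff_eq hp hq).mp h)
  obtain ⟨K, hK⟩ := not_pow_sub_one_dvd hq.one_lt (A := p ^ c * C * p ^ N) (B := p ^ c * C)
    (by have := hp.pos; positivity) (by have := hp.pos; positivity) fun i => by
    have h0 : p ^ c * C ≠ 0 := by have := hp.pos; positivity
    constructor
    · intro h
      refine hpq' (hp.dvd_of_dvd_pow (n := i) ?_)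
      rw [← Nat.eq_of_mul_eq_mul_left (Nat.pos_of_ne_zero h0) h]
      exact dvd_pow_self p hN.ne'
    · intro h
      rw [mul_assoc] at h
      have h1 : p ^ N * q ^ i = 1 := Nat.eq_of_mul_eq_mul_left (Nat.pos_of_ne_zero h0) (by simpa)
      exact hp.one_lt.ne' (Nat.dvd_one.mp (h1 ▸ (dvd_pow_self p hN.ne').mul_right _))
  -- By Euler q^k ≡ q modulo p^(c+1), so p^c is also the exact power of p in q^k - 1.
  set k := 1 + (p ^ (c + 1)).totient * K
  have hk : K ≤ k :=
    (Nat.le_mul_of_pos_left K (Nat.totient_pos.mpr (pow_pos hp.pos (c + 1)))).trans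
      (Nat.le_add_left _ _)
  have h1 : q ^ k ≡ q [MOD p ^ (c + 1)] := by
    have hc : Nat.Coprime q (p ^ (c + 1)) :=
      ((hp.coprime_iff_not_dvd.mpr hpq').pow_left _).symm
    have := ((Nat.ModEq.pow_totient hc).pow K).mul_left q
    simpa [k, pow_add, pow_mul] using this
  have h2 : q ^ k - 1 ≡ q - 1 [MOD p ^ (c + 1)] :=
    Nat.ModEq.sub (Nat.one_le_pow _ _ hq.pos) hq.one_le h1 rfl
  have h3 : p ^ c ∣ q ^ k - 1 :=
    (h2.dvd_iff (pow_dvd_pow p (Nat.le_succ c))).mpr (e ▸ dvd_mul_right _ _)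
  obtain ⟨M, hM⟩ := h3
  have h4 : 1 < q ^ k := Nat.one_lt_pow (by omega) hq.one_lt
  refine ⟨M, Nat.pos_of_ne_zero fun h => by subst h; simp at hM; omega, fun h => ?_, fun h => ?_,
    fun j h => hK k hk j ?_⟩
  · have h5 : p ^ (c + 1) ∣ q - 1 := (h2.dvd_iff dvd_rfl).mp
      (by rw [hM, pow_succ]; exact mul_dvd_mul_left _ h)
    rw [e, pow_succ] at h5
    exact hm (Nat.dvd_of_mul_dvd_mul_left (pow_pos hp.pos c) h5)
  · have h5 : q ∣ q ^ k - 1 := hM ▸ h.mul_left _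
    have h6 : q ∣ q ^ k := dvd_pow_self q (by omega)
    have h7 := (Nat.dvd_sub_iff_right h4.le h6).mp h5
    exact hq.one_lt.ne' (Nat.dvd_one.mp h7)
  · have h5 : (q : ℤ) ^ k - 1 = (p : ℤ) ^ c * M := by
      have : q ^ k = p ^ c * M + 1 := by omega
      zify at this
      linarith
    have h6 : ((p ^ c * C * p ^ N : ℕ) : ℤ) - ((p ^ c * C : ℕ) : ℤ) * (q : ℤ) ^ j =
        (p : ℤ) ^ c * (C * ((p : ℤ) ^ N - (q : ℤ) ^ j)) := by
      push_cast
      ring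
    rw [h5, h6]
    exact mul_dvd_mul_left ((p : ℤ) ^ c) h

end Arithmetic


open IsLocalRing Polynomial IntermediateField

theorem ne_zero_of_not_dvd {p M : ℕ} (hM : ¬ p ∣ M) : M ≠ 0 := fun h => hM (h ▸ dvd_zero p)

/-! ### Ramification, roots of unity and Eisenstein polynomials -/

section RootsOfUnity

variable (p : ℕ) [Fact p.Prime] {L : Type*} [Field L] [Algebra ℚ_[p] L] [FiniteDimensional ℚ_[p] L]

attribute [local instance] padicIntAlgebra

instance : Module.Free ℤ_[p] (valuationRing p L) :=
  have : FaithfulSMul ℤ_[p] (valuationRing p L) := (faithfulSMul_iff_algebraMap_injective _ _).mpr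
    (algebraMap_valuationRing_injective p L)
  inferInstance

variable (L) in
theorem ramificationIndex_dvd_finrank : ramificationIndex p L ∣ Module.finrank ℚ_[p] L := by
  rw [IsFractionRing.finrank_eq ℤ_[p] ℚ_[p] (valuationRing p L) L]
  have := Fintype.ofFinite ((maximalIdeal ℤ_[p]).primesOver (valuationRing p L))
  rw [← Ideal.sum_ramification_inertia_eq_finrank (maximalIdeal ℤ_[p])]
  refine Finset.dvd_sum fun Q _ => Dvd.dvd.mul_right ?_ _
  have : Q.1.LiesOver (maximalIdeal ℤ_[p]) := Q.2.2
  have hQ : Q.1 = maximalIdeal (valuationRing p L) :=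
    eq_maximalIdeal (Ideal.IsMaximal.of_liesOver_isMaximal Q.1 (maximalIdeal ℤ_[p]))
  rw [hQ, ramificationIndex]

variable (L) in
theorem ramificationIndex_eq_one [IsGalois ℚ_[p] L] (h : inertiaGroup p L = ⊥) :
    ramificationIndex p L = 1 := by
  have := isGaloisGroup_valuationRing p L
  have hI : (maximalIdeal (valuationRing p L)).inertia Gal(L/ℚ_[p]) = ⊥ := by
    rw [← h]
    ext g
    rw [mem_inertiaGroup]
    constructor
    · intro hg z
      obtain ⟨x, rfl⟩ := residue_surjective z
      rw [← ResidueField.residue_smul, ← sub_eq_zero, ← map_sub, residue_eq_zero_iff]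
      exact hg x
    · intro hg x
      change _ ∈ maximalIdeal _
      rw [← residue_eq_zero_iff, map_sub, ResidueField.residue_smul, hg, sub_self]
  have h1 := Ideal.card_inertia_eq_ramificationIdxIn (G := Gal(L/ℚ_[p])) (maximalIdeal ℤ_[p])
    (maximalIdeal (valuationRing p L))
  rw [hI, Ideal.ramificationIdxIn_eq_ramificationIdx _ (maximalIdeal (valuationRing p L))
    Gal(L/ℚ_[p])] at h1
  rw [ramificationIndex, ← h1]
  simp

theorem p_notMem_sq_of_ramificationIndex_eq_one (h : ramificationIndex p L = 1) :
    (p : valuationRing p L) ∉ maximalIdeal (valuationRing p L) ^ 2 := by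
  intro hp
  have hmap : (maximalIdeal ℤ_[p]).map (algebraMap ℤ_[p] (valuationRing p L)) =
      Ideal.span {(p : valuationRing p L)} := by
    rw [PadicInt.maximalIdeal_eq_span_p, Ideal.map_span]
    simp
  have h0 : Ideal.span {(p : valuationRing p L)} ≠ ⊥ := by
    simpa using p_ne_zero_valuationRing p L
  rw [ramificationIndex, Ideal.IsDedekindDomain.ramificationIdx_eq_multiplicity
    (maximalIdeal ℤ_[p]) _ (hmap ▸ h0), hmap] at h
  have hprime : Prime (maximalIdeal (valuationRing p L)) :=
    Ideal.prime_of_isPrime (IsDiscreteValuationRing.not_a_field _) inferInstance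
  have h2 := (FiniteMultiplicity.of_prime_left hprime h0).pow_dvd_iff_le_multiplicity (k := 2)
  rw [Ideal.dvd_iff_le, h, Ideal.span_singleton_le_iff_mem] at h2
  exact absurd (h2.mp hp) (by norm_num)

variable {p}

theorem specNorm_eq_one_of_pow_eq_one {M : ℕ} (hM : M ≠ 0) {ζ : L} (h : ζ ^ M = 1) :
    spectralNorm ℚ_[p] L ζ = 1 := by
  have h1 := specNorm_pow p ζ M
  rw [h, spectralNorm_one] at h1
  exact (pow_eq_one_iff_of_nonneg (spectralNorm_nonneg _) hM).mp h1.symm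

/-- The ratio r = gζ/ζ has r^M = 1 and residue 1; the geometric sum of r reduces to M ≠ 0, so r = 1.
-/
theorem apply_eq_self_of_mem_inertiaGroup {g : Gal(L/ℚ_[p])} (hg : g ∈ inertiaGroup p L) {M : ℕ}
    (hM : ¬ p ∣ M) {ζ : L} (h : ζ ^ M = 1) : g ζ = ζ := by
  have hM0 := ne_zero_of_not_dvd hM
  have hz : spectralNorm ℚ_[p] L ζ = 1 := specNorm_eq_one_of_pow_eq_one hM0 h
  have hζ0 : ζ ≠ 0 := by
    rintro rfl
    simp [hM0] at h
  have h1 := residue_ratio_eq_one hg hz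
  have h2 : ratio g ζ ^ M = 1 := Subtype.ext <| by simp [ratio, div_pow, ← map_pow, h]
  have h3 := geom_sum_mul (ratio g ζ) M
  rw [h2, sub_self, mul_eq_zero] at h3
  rcases h3 with h3 | h3
  · have h4 := congrArg (residue _) h3
    rw [map_sum] at h4
    simp only [map_pow, h1, one_pow, Finset.sum_const, Finset.card_range, nsmul_eq_mul, mul_one,
      map_zero] at h4
    exact absurd ((CharP.cast_eq_zero_iff _ p M).mp h4) hM
  · have h4 := congrArg Subtype.val (sub_eq_zero.mp h3)
    exact (div_eq_one_iff_eq hζ0).mp h4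

variable (p L) in
theorem exists_frobenius [IsGalois ℚ_[p] L] : ∃ σ : Gal(L/ℚ_[p]), ∀ (M : ℕ) (ζ : L), ¬ p ∣ M →
    ζ ^ M = 1 → σ ζ = ζ ^ p := by
  have := isGaloisGroup_valuationRing p L
  have : Finite (valuationRing p L ⧸ maximalIdeal (valuationRing p L)) :=
    inferInstanceAs (Finite (ResidueField (valuationRing p L)))
  obtain ⟨σ, hσ⟩ := IsArithFrobAt.exists_of_isInvariant ℤ_[p] Gal(L/ℚ_[p])
    (maximalIdeal (valuationRing p L))
  refine ⟨σ, fun M ζ hM h => ?_⟩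
  have hM0 := ne_zero_of_not_dvd hM
  have h1 := hσ.apply_of_pow_eq_one (ζ := ⟨ζ, (specNorm_eq_one_of_pow_eq_one hM0 h).le⟩) (m := M)
    (Subtype.ext h) (by rwa [← residue_eq_zero_iff, map_natCast, CharP.cast_eq_zero_iff _ p])
  have h2 : Nat.card (ℤ_[p] ⧸ (maximalIdeal (valuationRing p L)).under ℤ_[p]) = p := by
    rw [← Ideal.over_def (maximalIdeal (valuationRing p L)) (maximalIdeal ℤ_[p])]
    exact (Nat.card_congr PadicInt.residueField.toEquiv).trans (Nat.card_zmod p)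
  rw [h2] at h1
  exact congrArg Subtype.val h1

theorem irreducible_X_pow_sub_p (h : ramificationIndex p L = 1) {M : ℕ} (hM : M ≠ 0) :
    Irreducible (X ^ M - C (p : L)) := by
  set f : (valuationRing p L)[X] := X ^ M - C (p : valuationRing p L)
  have hf : f.Monic := monic_X_pow_sub_C _ hM
  have hdeg : f.natDegree = M := natDegree_X_pow_sub_C
  have hE : f.IsEisensteinAt (maximalIdeal (valuationRing p L)) :=
    { leading := by
        rw [hf.leadingCoeff]
        exact fun h1 => (Ideal.ne_top_iff_one _).mp (maximalIdeal.isMaximal _).ne_top h1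
      mem := fun {n} hn => by
        rw [coeff_sub, coeff_X_pow, if_neg (hdeg ▸ hn).ne, coeff_C]
        split_ifs
        · rw [zero_sub, neg_mem_iff]
          exact p_mem_maximalIdeal p L
        · simp
      notMem := by
        rw [coeff_sub, coeff_X_pow, if_neg hM.symm, coeff_C_zero, zero_sub, neg_mem_iff]
        exact p_notMem_sq_of_ramificationIndex_eq_one p h }
  have hirr := hE.irreducible (maximalIdeal.isMaximal _).isPrime hf.isPrimitive
    (hdeg ▸ Nat.pos_of_ne_zero hM)
  rw [hf.irreducible_iff_irreducible_map_fraction_map (K := L)] at hirr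
  simpa [f] using hirr

end RootsOfUnity

/-! ### Frobenius and tame generator on ζ_M and p^(1/M) -/

section AlgClosure

variable {p : ℕ} [Fact p.Prime] {Ω : Type*} [Field Ω] [Algebra ℚ_[p] Ω]
  [Normal ℚ_[p] Ω]

theorem finiteDimensional_adjoin_simple (ζ : Ω) : FiniteDimensional ℚ_[p] ℚ_[p]⟮ζ⟯ :=
  adjoin.finiteDimensional (Algebra.IsIntegral.isIntegral ζ)

theorem isGalois_adjoin_rootOfUnity {M : ℕ} (hM : M ≠ 0) {ζ : Ω}
    (hζ : IsPrimitiveRoot ζ M) : IsGalois ℚ_[p] ℚ_[p]⟮ζ⟯ := by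
  have : NeZero M := ⟨hM⟩
  have := hζ.intermediateField_adjoin_isCyclotomicExtension ℚ_[p]
  exact IsCyclotomicExtension.isGalois {M} _ _

theorem ramificationIndex_adjoin_rootOfUnity {M : ℕ} (hM : ¬ p ∣ M) {ζ : Ω}
    (hζ : IsPrimitiveRoot ζ M) [FiniteDimensional ℚ_[p] ℚ_[p]⟮ζ⟯] :
    ramificationIndex p ℚ_[p]⟮ζ⟯ = 1 := by
  have := isGalois_adjoin_rootOfUnity (p := p) (ne_zero_of_not_dvd hM) hζ
  refine ramificationIndex_eq_one p _ ((Subgroup.eq_bot_iff_forall _).mpr fun g hg => ?_)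
  have h1 : g (AdjoinSimple.gen ℚ_[p] ζ) = AdjoinSimple.gen ℚ_[p] ζ :=
    apply_eq_self_of_mem_inertiaGroup hg hM (Subtype.ext hζ.pow_eq_one)
  refine AlgEquiv.coe_toAlgHom_injective
    ((adjoin.powerBasis (Algebra.IsIntegral.isIntegral ζ)).algHom_ext ?_)
  rw [adjoin.powerBasis_gen]
  exact h1

theorem exists_apply_rootOfUnity_eq_pow {M : ℕ} (hM : ¬ p ∣ M) {ζ : Ω}
    (hζ : IsPrimitiveRoot ζ M) : ∃ s : Gal(Ω/ℚ_[p]), s ζ = ζ ^ p := by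
  have hM0 := ne_zero_of_not_dvd hM
  have := finiteDimensional_adjoin_simple (p := p) ζ
  have := isGalois_adjoin_rootOfUnity (p := p) hM0 hζ
  obtain ⟨σ, hσ⟩ := exists_frobenius p ℚ_[p]⟮ζ⟯
  refine ⟨σ.liftNormal Ω, ?_⟩
  have h1 := σ.liftNormal_commutes Ω (AdjoinSimple.gen ℚ_[p] ζ)
  rw [hσ M _ hM (Subtype.ext hζ.pow_eq_one)] at h1
  simpa using h1

/-- ℚ_p(ζ) is unramified, so X^M - p is Eisenstein over it, and x and ζx are conjugate. -/
theorem exists_apply_root_p_eq_mul {M : ℕ} (hM : ¬ p ∣ M) {ζ x : Ω}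
    (hζ : IsPrimitiveRoot ζ M) (hx : x ^ M = p) :
    ∃ t : Gal(Ω/ℚ_[p]), t ζ = ζ ∧ t x = ζ * x := by
  have hM0 := ne_zero_of_not_dvd hM
  have := finiteDimensional_adjoin_simple (p := p) ζ
  set K := ℚ_[p]⟮ζ⟯
  have hirr := irreducible_X_pow_sub_p (L := K) (ramificationIndex_adjoin_rootOfUnity hM hζ) hM0
  have hmin : minpoly K x = X ^ M - C (p : K) :=
    (minpoly.eq_of_irreducible_of_monic hirr (by simp [hx]) (monic_X_pow_sub_C _ hM0)).symm
  have : Normal K Ω := Normal.tower_top_of_normal ℚ_[p] K Ω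
  obtain ⟨σ, hσ⟩ := minpoly.exists_algEquiv_of_root' (K := K) (x := ζ * x) (y := x)
    (Algebra.IsAlgebraic.isAlgebraic x) (by simp [hmin, mul_pow, hx, hζ.pow_eq_one])
  exact ⟨σ.restrictScalars ℚ_[p], σ.commutes (AdjoinSimple.gen ℚ_[p] ζ), hσ⟩

end AlgClosure

/-! ### Elements of the maximal tame extension -/

section MaxTame

variable {p : ℕ} [Fact p.Prime]

theorem le_maxTame (L : IntermediateField ℚ_[p] (AlgebraicClosure ℚ_[p]))
    [hf : FiniteDimensional ℚ_[p] L] (h : IsTamelyRamified p L) : L ≤ maxTame p :=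
  le_iSup_of_le L (le_iSup_of_le hf (le_iSup_of_le h le_rfl))

theorem rootOfUnity_mem_maxTame {M : ℕ} (hM : ¬ p ∣ M) {ζ : AlgebraicClosure ℚ_[p]}
    (hζ : IsPrimitiveRoot ζ M) : ζ ∈ maxTame p := by
  have := finiteDimensional_adjoin_simple (p := p) ζ
  refine le_maxTame ℚ_[p]⟮ζ⟯ ?_ (mem_adjoin_simple_self _ ζ)
  rw [IsTamelyRamified, ramificationIndex_adjoin_rootOfUnity hM hζ]
  exact (Fact.out : p.Prime).one_lt.ne' ∘ Nat.dvd_one.mp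

theorem ramificationIndex_self : ramificationIndex p ℚ_[p] = 1 :=
  Nat.dvd_one.mp (Module.finrank_self ℚ_[p] ▸ ramificationIndex_dvd_finrank p ℚ_[p])

theorem root_p_mem_maxTame {M : ℕ} (hM : ¬ p ∣ M) {x : AlgebraicClosure ℚ_[p]}
    (hx : x ^ M = p) : x ∈ maxTame p := by
  have hM0 := ne_zero_of_not_dvd hM
  have hirr := irreducible_X_pow_sub_p (L := ℚ_[p]) ramificationIndex_self hM0
  have hmin : minpoly ℚ_[p] x = X ^ M - C (p : ℚ_[p]) :=
    (minpoly.eq_of_irreducible_of_monic hirr (by simp [hx]) (monic_X_pow_sub_C _ hM0)).symm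
  have hint : IsIntegral ℚ_[p] x := Algebra.IsIntegral.isIntegral x
  have := adjoin.finiteDimensional hint
  refine le_maxTame ℚ_[p]⟮x⟯ (fun h => hM ?_) (mem_adjoin_simple_self _ x)
  have h1 := h.trans (ramificationIndex_dvd_finrank p ℚ_[p]⟮x⟯)
  rwa [adjoin.finrank hint, hmin, natDegree_X_pow_sub_C] at h1

theorem exists_rootOfUnity_and_root_p {Ξ : Type*} [Field Ξ] [Algebra ℚ_[p] Ξ]
    (φ : maxTame p →ₐ[ℚ_[p]] Ξ) {M : ℕ} (hM : ¬ p ∣ M) :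
    ∃ ζ x : Ξ, IsPrimitiveRoot ζ M ∧ x ^ M = p := by
  have hM0 := ne_zero_of_not_dvd hM
  have : NeZero (M : AlgebraicClosure ℚ_[p]) := ⟨by
    have : CharZero (AlgebraicClosure ℚ_[p]) :=
      charZero_of_injective_algebraMap (algebraMap ℚ_[p] _).injective
    exact_mod_cast hM0⟩
  obtain ⟨ζ, hζ⟩ := HasEnoughRootsOfUnity.exists_primitiveRoot (AlgebraicClosure ℚ_[p]) M
  obtain ⟨x, hx⟩ := IsAlgClosed.exists_pow_nat_eq (p : AlgebraicClosure ℚ_[p])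
    (Nat.pos_of_ne_zero hM0)
  refine ⟨φ ⟨ζ, rootOfUnity_mem_maxTame hM hζ⟩, φ ⟨x, root_p_mem_maxTame hM hx⟩,
    IsPrimitiveRoot.map_of_injective (f := φ) ?_ φ.injective, ?_⟩
  · exact IsPrimitiveRoot.of_map_of_injective (f := (maxTame p).val) hζ (maxTame p).val.injective
  · rw [← map_pow, show (⟨x, _⟩ : maxTame p) ^ M = p from Subtype.ext hx, map_natCast]

end MaxTame


/-! ### Descending uniform powers to Gal(Ξ/F) -/

section Restriction

/-- Automorphisms over k need not fix F, but they permute the finitely many embeddings F → Ω. With N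
the order of that symmetric group, every N-th power fixes F, hence restricts to the normal extension
Ξ. -/
theorem exists_pow_eq_restriction (k F Ξ Ω : Type*) [Field k] [Field F] [Field Ξ] [Field Ω]
    [Algebra k F] [FiniteDimensional k F] [Algebra k Ω] [Algebra F Ξ] [Normal F Ξ] [Algebra F Ω]
    [IsScalarTower k F Ω] [Algebra Ξ Ω] [IsScalarTower F Ξ Ω] :
    ∃ N : ℕ, 0 < N ∧ ∀ g : Gal(Ω/k), ∃ h : Gal(Ξ/F), ∀ y : Ξ,
      algebraMap Ξ Ω (h y) = (g ^ N) (algebraMap Ξ Ω y) := by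
  let : MulAction Gal(Ω/k) (F →ₐ[k] Ω) :=
    { smul g φ := (g : Ω →ₐ[k] Ω).comp φ
      one_smul _ := rfl
      mul_smul _ _ _ := rfl }
  refine ⟨Nat.card (Equiv.Perm (F →ₐ[k] Ω)), Nat.card_pos, fun g => ?_⟩
  set N := Nat.card (Equiv.Perm (F →ₐ[k] Ω))
  have h1 : g ^ N • IsScalarTower.toAlgHom k F Ω = IsScalarTower.toAlgHom k F Ω := by
    have : MulAction.toPermHom Gal(Ω/k) (F →ₐ[k] Ω) (g ^ N) = 1 := by rw [map_pow, pow_card_eq_one']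
    exact congrArg (fun f : Equiv.Perm _ => f (IsScalarTower.toAlgHom k F Ω)) this
  let χ : Ω ≃ₐ[F] Ω := AlgEquiv.ofRingEquiv (f := (g ^ N : Gal(Ω/k)).toRingEquiv)
    fun r => congrArg (fun f : F →ₐ[k] Ω => f r) h1
  exact ⟨χ.restrictNormal Ξ, fun y => χ.restrictNormal_commutes Ξ y⟩

end Restriction

/-! ### Kummer shifts -/

section Tame

variable {F Ξ : Type*} [Field F] [Field Ξ] [Algebra F Ξ]

/-- `g` fixes `ζ` and multiplies `x` by `ζ ^ i`. -/
def IsKummerShift (ζ x : Ξ) (g : Gal(Ξ/F)) (i : ℤ) : Prop := g ζ = ζ ∧ g x = ζ ^ i * x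

variable {ζ x : Ξ} {g h : Gal(Ξ/F)} {i j : ℤ}

theorem IsKummerShift.mul (h0 : ζ ≠ 0) (hg : IsKummerShift ζ x g i) (hh : IsKummerShift ζ x h j) :
    IsKummerShift ζ x (g * h) (i + j) := by
  refine ⟨by rw [AlgEquiv.mul_apply, hh.1, hg.1], ?_⟩
  rw [AlgEquiv.mul_apply, hh.2, map_mul, map_zpow₀, hg.1, hg.2, zpow_add₀ h0]
  ring

theorem IsKummerShift.inv (h0 : ζ ≠ 0) (hg : IsKummerShift ζ x g i) :
    IsKummerShift ζ x g⁻¹ (-i) := by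
  have h1 : g⁻¹ ζ = ζ := by
    conv_lhs => rw [← hg.1]
    exact AlgEquiv.symm_apply_apply g ζ
  refine ⟨h1, ?_⟩
  have h2 : g⁻¹ (g x) = x := AlgEquiv.symm_apply_apply g x
  rw [hg.2, map_mul, map_zpow₀, h1] at h2
  rw [zpow_neg, ← h2, inv_mul_cancel_left₀ (zpow_ne_zero _ h0), h2]

theorem IsKummerShift.pow (h0 : ζ ≠ 0) (hg : IsKummerShift ζ x g i) (n : ℕ) :
    IsKummerShift ζ x (g ^ n) (n * i) := by
  induction n with
  | zero => exact ⟨rfl, by simp⟩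
  | succ n ih =>
    have := ih.mul h0 hg
    rw [← pow_succ] at this
    convert this using 1
    push_cast
    ring

/-- As x^M lies in F, g⁻¹x/x is an M-th root of unity, which h fixes; so h shifts g⁻¹x as it shifts
x. -/
theorem IsKummerShift.conj {M m : ℕ} (hM : M ≠ 0) (hζ : IsPrimitiveRoot ζ M) {y : F}
    (hx : x ^ M = algebraMap F Ξ y) (hx0 : x ≠ 0) (hg : g ζ = ζ ^ m)
    (hh : IsKummerShift ζ x h i) : IsKummerShift ζ x (g * h * g⁻¹) (m * i) := by
  have : NeZero M := ⟨hM⟩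
  have h0 : ζ ≠ 0 := hζ.ne_zero hM
  have hgg (z : Ξ) : g (g⁻¹ z) = z := AlgEquiv.apply_symm_apply g z
  have hroot {z : Ξ} (hz : z ^ M = 1) : h z = z := by
    obtain ⟨k, -, rfl⟩ := hζ.eq_pow_of_pow_eq_one hz
    rw [map_pow, hh.1]
  constructor
  · rw [AlgEquiv.mul_apply, AlgEquiv.mul_apply,
      hroot (by rw [← map_pow, hζ.pow_eq_one, map_one]), hgg]
  · have h1 : h (g⁻¹ x / x) = g⁻¹ x / x := hroot (by
      rw [div_pow, ← map_pow, hx, AlgEquiv.commutes, div_self]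
      rw [← hx]
      exact pow_ne_zero _ hx0)
    have h2 : h (g⁻¹ x) = ζ ^ i * g⁻¹ x := by
      rw [map_div₀, hh.2, div_eq_div_iff (mul_ne_zero (zpow_ne_zero _ h0) hx0) hx0] at h1
      exact mul_right_cancel₀ hx0 (by rw [h1]; ring)
    rw [AlgEquiv.mul_apply, AlgEquiv.mul_apply, h2, map_mul, map_zpow₀, hg, hgg, zpow_mul,
      zpow_natCast]

end Tame

/-! ### The two abundant cases -/

section Main

theorem normal_algebraicClosure (p : ℕ) [Fact p.Prime] (F : Type*) [Field F] [Algebra ℚ_[p] F]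
    [FiniteDimensional ℚ_[p] F] (Ξ : Type*) [Field Ξ] [Algebra F Ξ] [IsGalois F Ξ]
    [Algebra ℚ_[p] Ξ] [IsScalarTower ℚ_[p] F Ξ] : Normal ℚ_[p] (AlgebraicClosure Ξ) := by
  have : Algebra.IsAlgebraic ℚ_[p] F := inferInstance
  have : Algebra.IsAlgebraic ℚ_[p] Ξ := Algebra.IsAlgebraic.trans ℚ_[p] F Ξ
  have : Algebra.IsAlgebraic ℚ_[p] (AlgebraicClosure Ξ) := Algebra.IsAlgebraic.trans ℚ_[p] Ξ _
  have : IsAlgClosure ℚ_[p] (AlgebraicClosure Ξ) := ⟨inferInstance, inferInstance⟩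
  exact IsAlgClosure.normal _ _

variable {p : ℕ} [Fact p.Prime] {F : Type*} [Field F] [Algebra ℚ_[p] F] [FiniteDimensional ℚ_[p] F]
  {q : ℕ} [Fact q.Prime] {F' : Type*} [Field F'] [Algebra ℚ_[q] F'] [FiniteDimensional ℚ_[q] F']
  {Ξ : Type*} [Field Ξ] [Algebra F Ξ] [IsGalois F Ξ] [Algebra ℚ_[p] Ξ] [IsScalarTower ℚ_[p] F Ξ]
  {Ξ' : Type*} [Field Ξ'] [Algebra F' Ξ'] [IsGalois F' Ξ'] [Algebra ℚ_[q] Ξ']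
  [IsScalarTower ℚ_[q] F' Ξ']

theorem eq_of_maxTame (φ : maxTame p →ₐ[ℚ_[p]] Ξ) (α : Gal(Ξ/F) →ₜ* Gal(Ξ'/F'))
    (hα : Function.Injective α) : p = q := by
  by_contra hpq
  have hp : p.Prime := Fact.out
  have hq : q.Prime := Fact.out
  have := normal_algebraicClosure p F Ξ
  obtain ⟨N, hN, hres⟩ := exists_pow_eq_restriction ℚ_[p] F Ξ (AlgebraicClosure Ξ)
  -- The Kummer exponent of the commutator c below.
  have hC : 0 < N * (p ^ N - 1) :=
    Nat.mul_pos hN (Nat.sub_pos_of_lt (Nat.one_lt_pow hN.ne' hp.one_lt))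
  obtain ⟨M, hM0, hMp, hMq, hM⟩ := exists_modulus hp hq hpq hN hC
  obtain ⟨ζ, x, hζ, hx⟩ := exists_rootOfUnity_and_root_p φ hMp
  have hζ0 : ζ ≠ 0 := hζ.ne_zero hM0.ne'
  have : CharZero Ξ := charZero_of_injective_algebraMap (algebraMap ℚ_[p] Ξ).injective
  have hx0 : x ≠ 0 := by
    rintro rfl
    rw [zero_pow hM0.ne'] at hx
    exact hp.ne_zero (by exact_mod_cast hx.symm)
  let ι := algebraMap Ξ (AlgebraicClosure Ξ)
  have hζ' : IsPrimitiveRoot (ι ζ) M := hζ.map_of_injective ι.injective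
  obtain ⟨s, hs⟩ := exists_apply_rootOfUnity_eq_pow (p := p) hMp hζ'
  obtain ⟨t, ht, ht'⟩ := exists_apply_root_p_eq_mul (p := p) (x := ι x) hMp hζ'
    (by rw [← map_pow, hx, map_natCast])
  obtain ⟨a, ha⟩ := hres s
  obtain ⟨b, hb⟩ := hres t
  have haζ : a ζ = ζ ^ p ^ N := by
    refine ι.injective ?_
    rw [ha, map_pow]
    clear ha hb hres hC hM hN
    induction N with
    | zero => simp [ι]
    | succ n ih => rw [pow_succ', AlgEquiv.mul_apply, ih, map_pow, hs, ← pow_mul, pow_succ']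
  have hbN : IsKummerShift ζ x b N := by
    have h1 (n : ℕ) : (t ^ n) (ι ζ) = ι ζ ∧ (t ^ n) (ι x) = ι ζ ^ n * ι x := by
      induction n with
      | zero => simp
      | succ n ih =>
        rw [pow_succ', AlgEquiv.mul_apply, AlgEquiv.mul_apply, ih.1, ih.2, map_mul, map_pow, ht, ht']
        exact ⟨rfl, by ring⟩
    refine ⟨ι.injective (by rw [hb, (h1 N).1]), ι.injective ?_⟩
    rw [hb, (h1 N).2, zpow_natCast, map_mul, map_pow]
  have hxF : x ^ M = algebraMap F Ξ p := by rw [hx, map_natCast]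
  have hc := (hbN.conj hM0.ne' hζ hxF hx0 haζ).mul hζ0 (hbN.inv hζ0)
  set c := a * b * a⁻¹ * b⁻¹
  obtain ⟨E, _, _, hE⟩ := exists_level_of_isOpen α hα (MulAction.stabilizer Gal(Ξ/F) x)
    (stabilizer_isOpen_of_isIntegral x) (one_mem (MulAction.stabilizer Gal(Ξ/F) x))
  have hcI : α c ∈ inertiaAt q E := by
    simpa only [c, map_mul, map_inv] using commutator_mem_inertiaAt (q := q) E (α a) (α b)
  obtain ⟨j, hj⟩ := exists_frobOn q E (α a)
  have hw := conj_mul_inv_pow_mem_wildAt hj hcI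
  obtain ⟨r, hr⟩ := exists_pow_mem_fixingSubgroup hw
  rw [← map_inv, ← map_pow, ← map_inv, ← map_mul, ← map_mul, ← map_mul, ← map_pow] at hr
  have hfix : _ = x := hE _ hr
  -- The element fixing x has Kummer exponent q^r C (p^N - q^j), and q^r is prime to M.
  have hu := (((hc.conj hM0.ne' hζ hxF hx0 haζ).mul hζ0 ((hc.pow hζ0 (q ^ j)).inv hζ0)).pow hζ0
    (q ^ r)).2
  replace hu := hu.symm.trans hfix
  rw [mul_eq_right₀ hx0, hζ.zpow_eq_one_iff_dvd] at hu
  refine hM j ?_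
  have hcop : IsCoprime (M : ℤ) ((q ^ r : ℕ) : ℤ) := Nat.isCoprime_iff_coprime.mpr
    (((hq.coprime_iff_not_dvd.mpr hMq).pow_left r).symm)
  have h2 := hcop.dvd_of_dvd_mul_left hu
  have h1 : ((N * (p ^ N - 1) : ℕ) : ℤ) = N * ((p : ℤ) ^ N - 1) := by
    push_cast [Nat.one_le_pow N p hp.pos]
    ring
  rw [h1]
  refine h2.trans (dvd_of_eq ?_)
  push_cast
  ring

omit [FiniteDimensional ℚ_[p] F] in
theorem continuous_restrict (E : IntermediateField ℚ_[p] Ξ) [Normal ℚ_[p] E] :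
    Continuous ((AlgEquiv.restrictNormalHom E).comp (AlgEquiv.restrictScalarsHom ℚ_[p]) :
      Gal(Ξ/F) →* Gal(E/ℚ_[p])) := by
  refine continuous_of_continuousAt_one _ fun V hV => ?_
  rw [map_one] at hV
  obtain ⟨E₁, _, hE₁⟩ := (krullTopology_mem_nhds_one_iff _ _ V).mp hV
  let b := Module.finBasis ℚ_[p] E₁
  have hopen : IsOpen (⋂ i, (MulAction.stabilizer Gal(Ξ/F) ((b i : E) : Ξ) : Set Gal(Ξ/F))) :=
    isOpen_iInter_of_finite fun i => stabilizer_isOpen_of_isIntegral _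
  rw [Filter.mem_map]
  refine Filter.mem_of_superset (hopen.mem_nhds (Set.mem_iInter.mpr fun i => one_mem _))
    fun h hh => hE₁ ?_
  rw [SetLike.mem_coe, IntermediateField.mem_fixingSubgroup_iff]
  intro x hx
  have hcoe (y : E) : ((((AlgEquiv.restrictNormalHom E).comp (AlgEquiv.restrictScalarsHom ℚ_[p]) :
      Gal(Ξ/F) →* Gal(E/ℚ_[p])) h y : E) : Ξ) = h y :=
    AlgEquiv.restrictNormal_commutes (AlgEquiv.restrictScalars ℚ_[p] h) E y
  refine Subtype.ext ?_
  rw [hcoe]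
  have key : ((AlgEquiv.restrictScalars ℚ_[p] h : Ξ →ₐ[ℚ_[p]] Ξ).comp
      (E.val.comp E₁.val)).toLinearMap = (E.val.comp E₁.val).toLinearMap :=
    b.ext fun i => Set.mem_iInter.mp hh i
  exact congrArg (fun f : E₁ →ₗ[ℚ_[p]] Ξ => f ⟨x, hx⟩) key

theorem isOpen_setOf_pow_dvd (n : ℕ) : IsOpen {z : Multiplicative (ℤ_[p] × ℤ_[p]) |
    (p : ℤ_[p]) ^ n ∣ z.toAdd.1 ∧ (p : ℤ_[p]) ^ n ∣ z.toAdd.2} := by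
  have h1 : IsOpen {x : ℤ_[p] | (p : ℤ_[p]) ^ n ∣ x} := by
    have h2 : {x : ℤ_[p] | (p : ℤ_[p]) ^ n ∣ x} = Metric.closedBall 0 ((p : ℝ) ^ (-n : ℤ)) := by
      ext x
      rw [mem_closedBall_zero_iff, PadicInt.norm_le_pow_iff_mem_span_pow, Ideal.mem_span_singleton]
      rfl
    rw [h2]
    exact IsUltrametricDist.isOpen_closedBall _
      (zpow_ne_zero _ (by exact_mod_cast (Fact.out : p.Prime).ne_zero))
  exact (h1.preimage (continuous_fst.comp continuous_toAdd)).inter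
    (h1.preimage (continuous_snd.comp continuous_toAdd))

theorem pow_dvd_of_isCoprime {n k : ℕ} {y u v : ℤ} (huv : IsCoprime u v) (hpq : p ≠ q)
    (h1 : (p : ℤ_[p]) ^ n ∣ ((q ^ k * (y * u) : ℤ) : ℤ_[p]))
    (h2 : (p : ℤ_[p]) ^ n ∣ ((q ^ k * (y * v) : ℤ) : ℤ_[p])) : (p : ℤ) ^ n ∣ y := by
  rw [PadicInt.pow_p_dvd_int_iff] at h1 h2
  have hcop : IsCoprime ((p : ℤ) ^ n) ((q : ℤ) ^ k) := IsCoprime.pow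
    (Nat.isCoprime_iff_coprime.mpr ((Nat.coprime_primes Fact.out Fact.out).mpr hpq))
  obtain ⟨a, b, hab⟩ := huv
  have := (((hcop.dvd_of_dvd_mul_left h1).mul_left a).add
    ((hcop.dvd_of_dvd_mul_left h2).mul_left b) : (p : ℤ) ^ n ∣ _)
  rwa [show a * (y * u) + b * (y * v) = y by linear_combination y * hab] at this

omit [Algebra ℚ_[p] F] [FiniteDimensional ℚ_[p] F] [Algebra ℚ_[p] Ξ] [IsScalarTower ℚ_[p] F Ξ] in
theorem eq_of_padicInt_prod_hom (ψ : Gal(Ξ/F) →* Multiplicative (ℤ_[p] × ℤ_[p]))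
    (hψ : Continuous ψ) {N : ℕ} (hN : 0 < N)
    (hsurj : ∀ z : Multiplicative (ℤ_[p] × ℤ_[p]), ∃ h, ψ h = z ^ N)
    (α : Gal(Ξ/F) →ₜ* Gal(Ξ'/F')) (hα : Function.Injective α) : p = q := by
  by_contra hpq
  have hp : p.Prime := Fact.out
  have hq : q.Prime := Fact.out
  have hlevel (n : ℕ) : ∃ E : IntermediateField F' Ξ', FiniteDimensional F' E ∧ Normal F' E ∧
      ∀ h, α h ∈ E.fixingSubgroup →
        (p : ℤ_[p]) ^ n ∣ (ψ h).toAdd.1 ∧ (p : ℤ_[p]) ^ n ∣ (ψ h).toAdd.2 :=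
    exists_level_of_isOpen α hα _ ((isOpen_setOf_pow_dvd n).preimage hψ) ⟨by simp, by simp⟩
  obtain ⟨a, ha⟩ := hsurj (Multiplicative.ofAdd (1, 0))
  obtain ⟨b, hb⟩ := hsurj (Multiplicative.ofAdd (0, 1))
  obtain ⟨c, m, hm, hNc⟩ := Nat.exists_eq_pow_mul_and_not_dvd hN.ne' p hp.ne_one
  -- One digit beyond the p-part of N, just enough to see that N(1,0) and N(0,1) are nonzero.
  obtain ⟨E₁, _, _, hE₁⟩ := hlevel (c + 1)
  obtain ⟨f, hf0, hf⟩ := exists_mem_inertiaAt_of_dvd q E₁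
  obtain ⟨r, f', hf', hfr⟩ := Nat.exists_eq_pow_mul_and_not_dvd hf0.ne' p hp.ne_one
  obtain ⟨n, hn⟩ := pow_dvd_of_pow_dvd_pow_sub_one hp hq hpq r
  -- The precision n forces p^r ∣ j; the extra c absorbs the p-part of N.
  obtain ⟨E', _, _, hE'⟩ := hlevel (n + c)
  let E := E₁ ⊔ E'
  have : FiniteDimensional F' E := IntermediateField.finiteDimensional_sup E₁ E'
  have : Normal F' E := IntermediateField.normal_sup F' Ξ' E₁ E'
  obtain ⟨u, v, huv, hI⟩ := exists_zpow_mul_zpow_mem_inertiaAt q E (α a) (α b)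
  rw [← map_zpow, ← map_zpow, ← map_mul] at hI
  -- Conjugation is invisible to ψ, so q^j ≡ 1 modulo p^n can be read off the inertial combination
  -- of a and b.
  have hdvd (g : Gal(Ξ/F)) (j : ℕ) (hj : FrobOn q E (α g) j) : p ^ r ∣ j := by
    have hw := conj_mul_inv_pow_mem_wildAt hj hI
    obtain ⟨k, hk⟩ := exists_pow_mem_fixingSubgroup hw
    rw [← map_inv, ← map_pow, ← map_inv, ← map_mul, ← map_mul, ← map_mul, ← map_pow] at hk
    obtain ⟨h1, h2⟩ := hE' _ (IntermediateField.fixingSubgroup_antitone le_sup_right hk)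
    have h3 : (p : ℤ) ^ (n + c) ∣ (1 - (q : ℤ) ^ j) * N := by
      refine pow_dvd_of_isCoprime (k := k) huv hpq ?_ ?_
      · convert h1 using 1
        simp [ha, hb]
        ring
      · convert h2 using 1
        simp [ha, hb]
        ring
    rw [hNc, pow_add, mul_comm] at h3
    push_cast at h3
    rw [mul_left_comm (1 - (q : ℤ) ^ j)] at h3
    have h4 := (mul_dvd_mul_iff_left (pow_ne_zero c (by exact_mod_cast hp.ne_zero))).mp h3
    have hcop : IsCoprime ((p : ℤ) ^ n) (m : ℤ) := IsCoprime.pow_left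
      (Nat.isCoprime_iff_coprime.mpr (hp.coprime_iff_not_dvd.mpr hm))
    have h5 := hcop.dvd_of_dvd_mul_right h4
    exact hn j ((dvd_neg.mpr h5).trans (by rw [neg_sub]))
  -- The exponent of g^f' is f' j, a multiple of f = p^r f'.
  have hin (g : Gal(Ξ/F)) : α g ^ f' ∈ inertiaAt q E₁ := by
    obtain ⟨j, hj⟩ := exists_frobOn q E (α g)
    refine hf _ _ ((hj.of_le le_sup_left).pow f') ?_
    rw [hfr, mul_comm]
    exact mul_dvd_mul_left _ (hdvd g j hj)
  obtain ⟨u', v', huv', hW⟩ := exists_zpow_mul_zpow_mem_wildAt (hin a) (hin b)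
  obtain ⟨k, hk⟩ := exists_pow_mem_fixingSubgroup hW
  rw [← map_pow, ← map_zpow, ← map_pow, ← map_zpow, ← map_mul, ← map_pow] at hk
  obtain ⟨h1, h2⟩ := hE₁ _ hk
  have h3 : (p : ℤ) ^ (c + 1) ∣ (f' : ℤ) * N := by
    refine pow_dvd_of_isCoprime (k := k) huv' hpq ?_ ?_
    · convert h1 using 1
      simp [ha, hb]
      left
      ring
    · convert h2 using 1
      simp [ha, hb]
      left
      ring
  have h4 : p ^ c * p ∣ p ^ c * (f' * m) := by
    rw [← pow_succ, mul_left_comm, ← hNc]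
    exact_mod_cast h3
  rcases hp.dvd_mul.mp (Nat.dvd_of_mul_dvd_mul_left (pow_pos hp.pos c) h4) with h | h
  · exact hf' h
  · exact hm h

theorem eq_of_isAbundant (hΞ : IsAbundant p Ξ) (α : Gal(Ξ/F) →ₜ* Gal(Ξ'/F'))
    (hα : Function.Injective α) : p = q := by
  rcases hΞ with ⟨⟨φ⟩⟩ | ⟨E, hE, ⟨e⟩⟩
  · exact eq_of_maxTame φ α hα
  · let ρ : Gal(Ξ/F) →* Gal(E/ℚ_[p]) :=
      (AlgEquiv.restrictNormalHom E).comp (AlgEquiv.restrictScalarsHom ℚ_[p])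
    have := normal_algebraicClosure p F Ξ
    obtain ⟨N, hN, hres⟩ := exists_pow_eq_restriction ℚ_[p] F Ξ (AlgebraicClosure Ξ)
    refine eq_of_padicInt_prod_hom (e.toMulEquiv.toMonoidHom.comp ρ)
      (e.continuous_toFun.comp (continuous_restrict E)) hN (fun z => ?_) α hα
    obtain ⟨g, rfl⟩ := e.surjective z
    obtain ⟨h, hh⟩ := hres (g.liftNormal (AlgebraicClosure Ξ))
    refine ⟨h, ?_⟩
    suffices hρ : ρ h = g ^ N by
      rw [MonoidHom.comp_apply, hρ]
      exact map_pow e g N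
    refine AlgEquiv.ext fun y => Subtype.ext ((algebraMap Ξ (AlgebraicClosure Ξ)).injective ?_)
    have h1 : ((ρ h y : E) : Ξ) = h y :=
      AlgEquiv.restrictNormal_commutes (AlgEquiv.restrictScalars ℚ_[p] h) E y
    rw [h1, hh]
    clear hh h1 hres hN
    induction N with
    | zero => rfl
    | succ n ih =>
      rw [pow_succ', AlgEquiv.mul_apply, ih, pow_succ', AlgEquiv.mul_apply]
      exact g.liftNormal_commutes (AlgebraicClosure Ξ) _

end Main

end PadicGalois

theorem mainTheorem9
    (p : ℕ) [Fact p.Prime] (F : Type*) [Field F] [Algebra ℚ_[p] F] [FiniteDimensional ℚ_[p] F]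
    (p' : ℕ) [Fact p'.Prime] (F' : Type*) [Field F'] [Algebra ℚ_[p'] F']
    [FiniteDimensional ℚ_[p'] F']
    (Ξ : Type*) [Field Ξ] [Algebra F Ξ] [IsGalois F Ξ]
    [Algebra ℚ_[p] Ξ] [IsScalarTower ℚ_[p] F Ξ]
    (Ξ' : Type*) [Field Ξ'] [Algebra F' Ξ'] [IsGalois F' Ξ']
    (hΞ : PadicGalois.IsAbundant p Ξ)
    (α : Gal(Ξ/F) →ₜ* Gal(Ξ'/F')) (hα : Function.Injective α) :
    PadicGalois.residueChar p F = PadicGalois.residueChar p' F' := by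
  let : Algebra ℚ_[p'] Ξ' := ((algebraMap F' Ξ').comp (algebraMap ℚ_[p'] F')).toAlgebra
  have : IsScalarTower ℚ_[p'] F' Ξ' := .of_algebraMap_eq' rfl
  rw [PadicGalois.residueChar_eq, PadicGalois.residueChar_eq]
  exact PadicGalois.eq_of_isAbundant hΞ α hα
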